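/- Let $X$ be a compact connected complex manifold of complex dimension $n\ge 3$, and let $\eta$ be (the fundamental form of) a smooth Hermitian metric on $X$ which is balanced, i.e. $d(\eta^{n-1})=0$, and not Kähler, i.e. $d\eta\not\equiv 0$. Let $\Delta_\eta u=\operatorname{tr}_\eta(i\partial\bar\partial u)$ be the Laplacian, so that $n\, i\partial\bar\partial u\wedge\eta^{n-1}=(\Delta_\eta u)\,\eta^n$, and let $|d\eta|_\eta$ be the pointwise norm of the 3-form $d\eta$. For any constant $c>0$ (for instance $c=\frac1{n!}$) consider $$L u=\frac{n}{n-1}\bigl(\Delta_\eta u-c\,|d\eta|_\eta^2\,u\bigr).$$ Then $L$ has trivial kernel: if $u:X\to\mathbb R$ is of class $C^2$ (in particular, if $u$ is smooth) and $Lu=0$ on $X$, then $u\equiv 0$. -/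

import Mathlib

open scoped Manifold ContDiff

noncomputable section

namespace BalancedGeometry

/-! ### Alternating forms on a real topological vector space -/

section Algebra

variable {V : Type*} [AddCommGroup V] [Module ℝ V] [TopologicalSpace V]

/-- The tensor product `(α ⊗ β)(v₁, …, v_{p+q}) = α(v₁, …, v_p) β(v_{p+1}, …, v_{p+q})`. -/
def tensor {p q : ℕ} (α : V [⋀^Fin p]→L[ℝ] ℝ) (β : V [⋀^Fin q]→L[ℝ] ℝ) :
    ContinuousMultilinearMap ℝ (fun _ : Fin (p + q) => V) ℝ where
  toMultilinearMap :=
    ((LinearMap.mul' ℝ ℝ).compMultilinearMap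
      (MultilinearMap.domCoprod α.toMultilinearMap β.toMultilinearMap)).domDomCongr finSumFinEquiv
  cont := by
    change Continuous fun v : Fin (p + q) → V =>
      α (fun i => v (finSumFinEquiv (Sum.inl i))) * β (fun i => v (finSumFinEquiv (Sum.inr i)))
    exact (α.cont.comp (by fun_prop)).mul (β.cont.comp (by fun_prop))

/-- The wedge product
`(α ∧ β)(v₁, …, v_{p+q}) = 1/(p! q!) ∑_σ sgn(σ) α(v_σ(1), …, v_σ(p)) β(v_σ(p+1), …, v_σ(p+q))`. -/
def wedge {p q : ℕ} (α : V [⋀^Fin p]→L[ℝ] ℝ) (β : V [⋀^Fin q]→L[ℝ] ℝ) :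
    V [⋀^Fin (p + q)]→L[ℝ] ℝ :=
  ((p.factorial * q.factorial : ℝ)⁻¹) •
    ContinuousMultilinearMap.alternatization (tensor α β)

/-- The power `ηᵏ = η ∧ ⋯ ∧ η` of a 2-form. -/
def wedgePow (η : V [⋀^Fin 2]→L[ℝ] ℝ) : (k : ℕ) → V [⋀^Fin (2 * k)]→L[ℝ] ℝ
  | 0 => (ContinuousAlternatingMap.constOfIsEmpty ℝ V (Fin 0) 1 : V [⋀^Fin 0]→L[ℝ] ℝ)
  | k + 1 => wedge (wedgePow η k) η

end Algebra

/-! ### Complex manifolds as real manifolds -/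

section Manifold

variable {E : Type*} [NormedAddCommGroup E] [NormedSpace ℂ E]
  {X : Type*} [TopologicalSpace X] [ChartedSpace E X]

/-- A complex manifold is a smooth (even analytic) real manifold. -/
instance isManifold_real (m : ℕ∞ω) [IsManifold 𝓘(ℂ, E) m X] : IsManifold 𝓘(ℝ, E) m X := by
  refine isManifold_of_contDiffOn _ _ _ fun e e' he he' => ?_
  have h : ContDiffOn ℂ m (𝓘(ℂ, E) ∘ (e.symm.trans e') ∘ 𝓘(ℂ, E).symm)
      (𝓘(ℂ, E).symm ⁻¹' (e.symm.trans e').source ∩ Set.range 𝓘(ℂ, E)) :=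
    ((contDiffGroupoid m 𝓘(ℂ, E)).compatible he he').1
  exact h.restrict_scalars ℝ

/-- The real tangent space of `X` at `x`. -/
abbrev Tan (E : Type*) [NormedAddCommGroup E] [NormedSpace ℂ E]
    {X : Type*} [TopologicalSpace X] [ChartedSpace E X] (x : X) : Type _ :=
  TangentSpace 𝓘(ℝ, E) x

/-- The complex structure `J` on the tangent space: multiplication by `i` in a holomorphic
chart. -/
def cplx (x : X) : Tan E x →L[ℝ] Tan E x :=
  (Complex.I • ContinuousLinearMap.id ℝ E : E →L[ℝ] E)

variable (E X) in
/-- Real differential forms of degree `k` on `X` (with no regularity imposed). -/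
abbrev Form (k : ℕ) : Type _ := (x : X) → Tan E x [⋀^Fin k]→L[ℝ] ℝ

/-- The form `α` read in the preferred chart `φ` at `x₀`, i.e. its pullback by `φ⁻¹`. -/
def Form.inChart {k : ℕ} (α : Form E X k) (x₀ : X) (y : E) : E [⋀^Fin k]→L[ℝ] ℝ :=
  (α ((extChartAt 𝓘(ℝ, E) x₀).symm y)).compContinuousLinearMap
    (mfderiv 𝓘(ℝ, E) 𝓘(ℝ, E) (extChartAt 𝓘(ℝ, E) x₀).symm y)

/-- The exterior derivative of a form. Its value at `x` is computed in the preferred chart at `x`,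
in which the tangent space at `x` is `E` itself. -/
def Form.d {k : ℕ} (α : Form E X k) : Form E X (k + 1) := fun x =>
  (extDeriv (α.inChart x) (extChartAt 𝓘(ℝ, E) x x) : E [⋀^Fin (k + 1)]→L[ℝ] ℝ)

/-- The 1-form `dᶜu = i(∂̄ - ∂)u = -du ∘ J`. -/
def dc (u : X → ℝ) : Form E X 1 := fun x =>
  ContinuousAlternatingMap.ofSubsingleton ℝ (Tan E x) ℝ (0 : Fin 1)
    (-((mfderiv 𝓘(ℝ, E) 𝓘(ℝ, ℝ) u x : Tan E x →L[ℝ] ℝ).comp (cplx x)))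

/-- The real (1,1)-form `i∂∂̄u = ½ d dᶜ u`. -/
def iddbar (u : X → ℝ) : Form E X 2 := fun x => (1 / 2 : ℝ) • (dc (E := E) u).d x

/-! ### Hermitian metrics -/

variable (E X) in
/-- A smooth Hermitian metric on a complex manifold, given by the Riemannian metric `g`, which is
invariant under `J`. -/
structure HermitianMetric [IsManifold 𝓘(ℂ, E) ω X] extends
    Bundle.ContMDiffRiemannianMetric 𝓘(ℝ, E) ∞ E (fun x : X => Tan E x) where
  hermitian (x : X) (v w : Tan E x) : inner x (cplx x v) (cplx x w) = inner x v w

namespace HermitianMetric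

variable [IsManifold 𝓘(ℂ, E) ω X] (g : HermitianMetric E X)

/-- The fundamental form `η(v, w) = g(Jv, w)`. -/
def form : Form E X 2 := fun x =>
  { toFun := fun v => g.inner x (cplx x (v 0)) (v 1)
    map_update_add' := by
      intro _ v i a b
      fin_cases i <;> simp [Function.update]
    map_update_smul' := by
      intro _ v i c a
      fin_cases i <;> simp [Function.update]
    cont := by
      have h : ∀ (B : E →L[ℝ] E →L[ℝ] ℝ) (T : E →L[ℝ] E),
          Continuous fun v : Fin 2 → E => B (T (v 0)) (v 1) := fun B T => by fun_prop
      exact h (g.inner x) (cplx x)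
    map_eq_zero_of_eq' := by
      have key : ∀ w : Tan E x, g.inner x (cplx x w) w = 0 := by
        intro w
        have h1 := g.hermitian x w (cplx x w)
        have h2 : cplx x (cplx x w) = -w := by
          have h : ∀ e : E, Complex.I • Complex.I • e = -e := fun e => by
            rw [smul_smul, Complex.I_mul_I, neg_one_smul]
          exact h w
        rw [h2, map_neg, g.symm x w] at h1
        linarith
      intro v i j h hij
      have h01 : v 0 = v 1 := by
        fin_cases i <;> fin_cases j <;> simp_all
      change g.inner x (cplx x (v 0)) (v 1) = 0
      rw [h01]
      exact key _ }

/-- The metric is balanced: `d(ηⁿ⁻¹) = 0`, where `n` is the complex dimension. -/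
def IsBalanced : Prop :=
  ∀ x, Form.d (E := E) (X := X) (fun y => wedgePow (g.form y) (Module.finrank ℂ E - 1)) x = 0

/-- The metric is Kähler: `dη = 0`. -/
def IsKahler : Prop := ∀ x, g.form.d x = 0

variable [FiniteDimensional ℂ E]

variable (E) in
/-- A fixed real basis of the tangent spaces, with respect to which traces and norms are computed
(they do not depend on it). -/
def frame (x : X) : Module.Basis (Fin (Module.finrank ℝ E)) ℝ (Tan E x) :=
  (Module.finBasis ℝ E : Module.Basis _ ℝ E)

/-- The Gram matrix `g_{ab}` of the metric in the frame. -/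
def gram (x : X) : Matrix (Fin (Module.finrank ℝ E)) (Fin (Module.finrank ℝ E)) ℝ :=
  fun a b => g.inner x (frame E x a) (frame E x b)

/-- The trace `tr_η β = ½ ∑ g^{ab} β(e_a, J e_b)` of a real 2-form with respect to the metric. For a
(1,1)-form it satisfies `n β ∧ ηⁿ⁻¹ = (tr_η β) ηⁿ`. -/
def trace (β : Form E X 2) (x : X) : ℝ :=
  (1 / 2 : ℝ) * ∑ a, ∑ b, (g.gram x)⁻¹ a b * β x ![frame E x a, cplx x (frame E x b)]

/-- The pointwise squared norm `|α|² = 1/k! ∑ g^{a₁b₁} ⋯ g^{a_k b_k} α_{a₁…a_k} α_{b₁…b_k}` of a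
`k`-form, in which the wedge products of `k` distinct covectors of an orthonormal coframe have
norm 1. -/
def normSq {k : ℕ} (α : Form E X k) (x : X) : ℝ :=
  (k.factorial : ℝ)⁻¹ * ∑ a : Fin k → Fin (Module.finrank ℝ E),
    ∑ b : Fin k → Fin (Module.finrank ℝ E),
      (∏ s, (g.gram x)⁻¹ (a s) (b s)) * α x (fun s => frame E x (a s)) *
        α x (fun s => frame E x (b s))

/-- The (Chern) Laplacian `Δ_η u = tr_η (i∂∂̄u)`, i.e. `n i∂∂̄u ∧ ηⁿ⁻¹ = (Δ_η u) ηⁿ`. -/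
def laplacian (u : X → ℝ) : X → ℝ := g.trace (iddbar u)

/-- The operator `L u = n/(n-1) (Δ_η u - c |dη|² u)`. -/
def L (c : ℝ) (u : X → ℝ) (x : X) : ℝ :=
  (Module.finrank ℂ E : ℝ) / ((Module.finrank ℂ E : ℝ) - 1) *
    (g.laplacian u x - c * g.normSq g.form.d x * u x)

/-- The kernel of `L` on the real functions of class `C²`. -/
def ker (c : ℝ) : Set (X → ℝ) :=
  {u | ContMDiff 𝓘(ℝ, E) 𝓘(ℝ, ℝ) 2 u ∧ ∀ x, g.L c u x = 0}

end HermitianMetric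

end Manifold

end BalancedGeometry

end

/-! Suppose `u` has a positive maximum. Near any maximum point `u > 0`, so `L u = 0` gives `Δ u = c
|dη|² u ≥ 0`, and the strong maximum principle makes `u` locally equal to its maximum. The contact
set is thus clopen, so `u` is a positive constant. The equation then forces `|dη|² = 0` everywhere,
against the failure of the Kähler condition. Hence `u ≤ 0`, and the same argument applied to `-u`
gives `u = 0`.

The maximum principle is Hopf's barrier argument. In the preferred chart at `x`, `Δ u` is a quarter
of the sum of the values of the Levi form on a `g`-orthonormal basis (`exists_orthonormal_basis`),
so it has no first-order term. The Levi form is invariant under holomorphic coordinate changes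
(`levi_comp`), which lets a barrier written in one fixed chart be tested at all nearby points. Only
local two-sided bounds on the metric are then needed (`eventually_chart_bounds`). -/

/-! ### Hopf's barrier argument in Euclidean space -/

open Filter Topology Metric in
/-- Hopf's strong maximum principle, for functions which do not admit a local maximum after adding
a small multiple of a suitable quadratic barrier. -/
theorem eventually_eq_of_barrier {F : Type*} [NormedAddCommGroup F] [InnerProductSpace ℝ F]
    [ProperSpace F] {f : F → ℝ} {p : F} {M : ℝ} {U : Set F} (hU : U ∈ 𝓝 p)
    (hf : ContinuousOn f U) (hfM : ∀ y ∈ U, f y ≤ M) (hp : f p = M)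
    (hbar : ∀ z ∈ U, f z = M → ∀ n : F, n ≠ 0 → ∃ N : ℝ, 0 < N ∧ ∀ᶠ y in 𝓝 z, ∀ ε : ℝ, 0 < ε →
      ¬ IsLocalMax (fun y => f y + ε * (inner ℝ n (y - z) + N * inner ℝ n (y - z) ^ 2
        - ‖y - z‖ ^ 2)) y) :
    ∀ᶠ y in 𝓝 p, f y = M := by
  obtain ⟨r', hr', hrU'⟩ := Metric.nhds_basis_closedBall.mem_iff.1 hU
  -- A third of the radius leaves room for `q` within `r` of `p`, the contact point `z` nearest to
  -- `q` within `2r`, and a ball of radius at most `r` around `z`.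
  obtain ⟨r, hr, rfl⟩ : ∃ r, 0 < r ∧ r' = 3 * r := ⟨r' / 3, by positivity, by ring⟩
  have hrU : ∀ y, dist y p ≤ 3 * r → y ∈ U := fun y hy => hrU' (mem_closedBall.2 hy)
  by_contra hne
  obtain ⟨q, hqr, hqM⟩ : ∃ q, dist q p < r ∧ f q ≠ M := by
    by_contra! h
    exact hne (Metric.eventually_nhds_iff.2 ⟨r, hr, fun y hy => h y hy⟩)
  -- a closest point of the contact set
  have hKc : IsCompact (closedBall p (3 * r) ∩ f ⁻¹' {M}) :=
    (isCompact_closedBall p (3 * r)).of_isClosed_subset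
      ((hf.mono hrU').preimage_isClosed_of_isClosed isClosed_closedBall isClosed_singleton)
      Set.inter_subset_left
  obtain ⟨z, ⟨hzp, hzM⟩, hzmin⟩ := hKc.exists_isMinOn
    ⟨p, by simp [hr.le], hp⟩ (f := fun y => dist y q) (by fun_prop)
  have hzM : f z = M := hzM
  have hzq : dist z q < r :=
    (hzmin (show p ∈ _ from ⟨by simp [hr.le], hp⟩) : dist z q ≤ dist p q).trans_lt
      (by simpa only [dist_comm] using hqr)
  have hzp2 : dist z p < 2 * r := by linarith [dist_triangle z q p]
  obtain ⟨n, rfl⟩ : ∃ n, q = z + (2 : ℝ) • n := ⟨(2 : ℝ)⁻¹ • (q - z), by simp [smul_smul]⟩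
  have hn : n ≠ 0 := by rintro rfl; exact hqM (by simpa using hzM)
  have hn0 : 0 < ‖n‖ := norm_pos_iff.2 hn
  have hnr : 2 * ‖n‖ < r := by simpa [dist_eq_norm, norm_smul] using hzq
  -- The ball with centre `z + n` and radius `‖n‖` is internally tangent at `z` to the contact-free
  -- ball around `q`, so it meets the contact set at most at `z`.
  have hin : ∀ y, ‖y - z‖ ^ 2 ≤ 2 * inner ℝ n (y - z) → y ≠ z → f y < M := by
    intro y hy hyz
    have h0 : 0 < ‖y - z‖ := norm_pos_iff.2 (sub_ne_zero.2 hyz)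
    have hle : ‖y - z‖ ≤ r := by nlinarith [real_inner_le_norm n (y - z)]
    have hyp : dist y p ≤ 3 * r := by
      linarith [dist_triangle y z p, dist_eq_norm y z]
    refine lt_of_le_of_ne (hfM y (hrU y hyp)) fun hyM => ?_
    have h1 : dist z (z + (2 : ℝ) • n) ≤ dist y (z + (2 : ℝ) • n) :=
      hzmin (show y ∈ _ from ⟨hyp, hyM⟩)
    have h2 : dist z (z + (2 : ℝ) • n) = 2 * ‖n‖ := by simp [dist_eq_norm, norm_smul]
    have h3 : dist y (z + (2 : ℝ) • n) ^ 2
        = ‖y - z‖ ^ 2 - 4 * inner ℝ n (y - z) + 4 * ‖n‖ ^ 2 := by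
      rw [dist_eq_norm, ← sub_sub, norm_sub_sq_real, inner_smul_right, norm_smul,
        real_inner_comm]
      norm_num
      ring
    rw [h2] at h1
    have h4 : (2 * ‖n‖) ^ 2 ≤ dist y (z + (2 : ℝ) • n) ^ 2 := by gcongr
    nlinarith
  obtain ⟨N, hN, hev⟩ := hbar z (hrU z hzp) hzM n hn
  obtain ⟨δ, hδ, hδN⟩ := Metric.eventually_nhds_iff.1 hev
  -- The last two bounds make `h` negative on the part of the sphere outside the tangent ball: the
  -- first serves where `inner ℝ n (y - z) ≤ 0`, the second where it is positive.
  obtain ⟨ρ, hρ, hρδ, hρr, hρ1, hρ2⟩ : ∃ ρ, 0 < ρ ∧ ρ < δ ∧ ρ ≤ r ∧ N * ρ * ‖n‖ ≤ 1 ∧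
      N * ρ ^ 2 ≤ 1 := by
    have h : ∀ᶠ ρ in 𝓝[>] (0 : ℝ), ρ < δ ∧ ρ ≤ r ∧ N * ρ * ‖n‖ ≤ 1 ∧ N * ρ ^ 2 ≤ 1 := by
      refine eventually_nhdsWithin_of_eventually_nhds ?_
      refine (gt_mem_nhds hδ).and ((ge_mem_nhds hr).and (.and ?_ ?_))
      · exact (ContinuousAt.eventually_lt (f := fun ρ : ℝ => N * ρ * ‖n‖) (by fun_prop)
          continuousAt_const (by simp)).mono fun _ => le_of_lt
      · exact (ContinuousAt.eventually_lt (f := fun ρ : ℝ => N * ρ ^ 2) (by fun_prop)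
          continuousAt_const (by simp)).mono fun _ => le_of_lt
    obtain ⟨ρ, h1, h2⟩ := (h.and self_mem_nhdsWithin).exists
    exact ⟨ρ, h2, h1⟩
  set h : F → ℝ := fun y => inner ℝ n (y - z) + N * inner ℝ n (y - z) ^ 2 - ‖y - z‖ ^ 2 with hh
  have hhc : Continuous h := by fun_prop
  have hBU : closedBall z ρ ⊆ U := fun y hy => hrU y (by
    linarith [dist_triangle y z p, mem_closedBall.1 hy])
  have hSc : IsCompact (sphere z ρ ∩ {y | ‖y - z‖ ^ 2 ≤ 2 * inner ℝ n (y - z)}) :=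
    (isCompact_sphere z ρ).inter_right (isClosed_le (by fun_prop) (by fun_prop))
  -- On the cap of the sphere inside the tangent ball, compactness gives a gap below `M`, which
  -- survives adding `ε * h` for small `ε`. Off the cap `h < 0`. So `f + ε * h` is below `M` on the
  -- sphere but equals `M` at `z`, and its maximum is interior.
  obtain ⟨m, hmM, hm⟩ : ∃ m < M, ∀ y ∈ sphere z ρ, ‖y - z‖ ^ 2 ≤ 2 * inner ℝ n (y - z) →
      f y ≤ m := by
    rcases (sphere z ρ ∩ {y | ‖y - z‖ ^ 2 ≤ 2 * inner ℝ n (y - z)}).eq_empty_or_nonempty with he | hS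
    · exact ⟨M - 1, by linarith, fun y hy hy' => ((he.le ⟨hy, hy'⟩ : y ∈ (∅ : Set F))).elim⟩
    · obtain ⟨y, hy, hmax⟩ := hSc.exists_isMaxOn hS
        (hf.mono fun w hw => hBU (sphere_subset_closedBall hw.1))
      exact ⟨f y, hin y hy.2 (ne_of_mem_sphere hy.1 hρ.ne'), fun w hw hw' => hmax ⟨hw, hw'⟩⟩
  obtain ⟨C, hC⟩ : ∃ C, ∀ y ∈ sphere z ρ, h y ≤ C := by
    obtain ⟨C, hC⟩ := ((isCompact_sphere z ρ).image hhc).bddAbove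
    exact ⟨C, fun y hy => hC ⟨y, hy, rfl⟩⟩
  obtain ⟨ε, hε, hεC⟩ : ∃ ε, 0 < ε ∧ m + ε * C < M := by
    have h1 : ∀ᶠ ε in 𝓝[>] (0 : ℝ), m + ε * C < M := by
      refine eventually_nhdsWithin_of_eventually_nhds ?_
      exact ContinuousAt.eventually_lt (f := fun ε : ℝ => m + ε * C) (by fun_prop)
          continuousAt_const (by simpa using hmM)
    obtain ⟨ε, h1, h2⟩ := (h1.and self_mem_nhdsWithin).exists
    exact ⟨ε, h2, h1⟩
  obtain ⟨y, hy, hmax⟩ := (isCompact_closedBall z ρ).exists_isMaxOn ⟨z, by simp [hρ.le]⟩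
    (f := fun y => f y + ε * h y) ((hf.mono hBU).add (by fun_prop))
  have hyM : M ≤ f y + ε * h y := by
    have := hmax (mem_closedBall_self hρ.le : z ∈ closedBall z ρ)
    simpa [hh, hzM] using this
  have hyb : dist y z < ρ := by
    refine lt_of_le_of_ne (mem_closedBall.1 hy) fun hyS => ?_
    have hyρ : ‖y - z‖ = ρ := by rw [← dist_eq_norm, hyS]
    rcases le_or_gt (‖y - z‖ ^ 2) (2 * inner ℝ n (y - z)) with hc | hc
    · have h1 := hm y hyS hc
      have h2 := mul_le_mul_of_nonneg_left (hC y hyS) hε.le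
      linarith
    · have hneg : h y < 0 := by
        have hs := neg_le_of_abs_le (abs_real_inner_le_norm n (y - z))
        simp only [hh]
        rw [hyρ] at hs hc ⊢
        set s := inner ℝ n (y - z)
        rcases le_or_gt s 0 with hs0 | hs0
        · have : 0 ≤ 1 + N * s := by nlinarith
          nlinarith [sq_pos_of_pos hρ]
        · have : N * s ≤ 1 := by nlinarith
          nlinarith
      have := hfM y (hBU hy)
      nlinarith
  refine hδN (hyb.trans hρδ) ε hε ?_
  filter_upwards [isOpen_ball.mem_nhds (mem_ball.2 hyb)]
    with w hw using hmax (ball_subset_closedBall hw)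

/-! ### Gram matrices and orthonormal bases -/

/-- A basis which is orthonormal for a positive definite form `G`, obtained from a given basis by a
matrix `Q` such that `QᵀQ` is the inverse of the Gram matrix. -/
theorem exists_orthonormal_basis_of_gram {V ι : Type*} [AddCommGroup V] [Module ℝ V] [Fintype ι]
    [DecidableEq ι] (b : Module.Basis ι ℝ V) (G : V →ₗ[ℝ] V →ₗ[ℝ] ℝ)
    (hsymm : ∀ v w, G v w = G w v) (hpos : ∀ v, v ≠ 0 → 0 < G v v) :
    ∃ (f : Module.Basis ι ℝ V) (Q : Matrix ι ι ℝ), (∀ i, f i = ∑ a, Q i a • b a) ∧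
      (Matrix.of fun i j => G (b i) (b j))⁻¹ = Q.transpose * Q ∧
      ∀ i j, G (f i) (f j) = if i = j then 1 else 0 := by
  set A : Matrix ι ι ℝ := Matrix.of fun i j => G (b i) (b j) with hA
  have hG : ∀ x y : ι → ℝ, G (∑ a, x a • b a) (∑ a, y a • b a) = x ⬝ᵥ A.mulVec y := by
    intro x y
    simp only [map_sum, map_smul, LinearMap.sum_apply, LinearMap.smul_apply, dotProduct,
      Matrix.mulVec, hA, Matrix.of_apply, smul_eq_mul, Finset.mul_sum]
    rw [Finset.sum_comm]
    exact Finset.sum_congr rfl fun i _ => Finset.sum_congr rfl fun j _ => by ring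
  have hAp : A.PosDef := by
    refine Matrix.PosDef.of_dotProduct_mulVec_pos ?_ fun x hx => ?_
    · ext i j
      simp [hA, hsymm (b i) (b j)]
    · rw [star_trivial, ← hG]
      refine hpos _ fun h => hx ?_
      ext i
      exact Fintype.linearIndependent_iff.1 b.linearIndependent x h i
  obtain ⟨Q, hQ⟩ : ∃ Q : Matrix ι ι ℝ, A⁻¹ = Q.transpose * Q := by
    open scoped MatrixOrder in
    obtain ⟨Q, hQ⟩ := CStarAlgebra.nonneg_iff_eq_star_mul_self.1 hAp.inv.posSemidef.nonneg
    exact ⟨Q, hQ⟩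
  have hAu : IsUnit A.det := hAp.det_pos.ne'.isUnit
  have hQA : Q * A * Q.transpose = 1 := by
    have h1 : Q.transpose * (Q * A) = 1 := by
      rw [← Matrix.mul_assoc, ← hQ, Matrix.nonsing_inv_mul _ hAu]
    exact mul_eq_one_comm.1 h1
  have horth : ∀ i j, G (∑ a, Q i a • b a) (∑ a, Q j a • b a) = if i = j then 1 else 0 := by
    intro i j
    rw [hG, ← Matrix.one_apply, ← hQA, Matrix.mul_assoc, Matrix.mul_apply]
    rfl
  obtain ⟨w, hw⟩ : ∃ w : ι → V, ∀ i, w i = ∑ a, Q i a • b a := ⟨_, fun _ => rfl⟩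
  simp only [← hw] at horth
  have hli : LinearIndependent ℝ w := by
    refine Fintype.linearIndependent_iff.2 fun c hc j => ?_
    have := congrArg (fun v => G v (w j)) hc
    simpa [horth] using this
  have := Module.Finite.of_basis b
  refine ⟨Module.Basis.mk hli (hli.span_eq_top_of_card_eq_finrank'
    (Module.finrank_eq_card_basis b).symm).ge, Q, fun i => ?_, hQ, fun i j => ?_⟩
  · simpa using hw i
  · simpa using horth i j

/-- Contraction with the inverse Gram matrix is a trace in the orthonormal basis: each factor of `Qᵀ
Q` is absorbed into one argument of `B`. -/
theorem sum_gram_inv_mul {V ι : Type*} [AddCommGroup V] [Module ℝ V] [Fintype ι]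
    {b f : ι → V} {Q : Matrix ι ι ℝ} (hf : ∀ i, f i = ∑ a, Q i a • b a) (B : V →ₗ[ℝ] V →ₗ[ℝ] ℝ) :
    ∑ i, ∑ j, (Q.transpose * Q) i j * B (b i) (b j) = ∑ i, B (f i) (f i) := by
  simp only [hf, map_sum, map_smul, LinearMap.sum_apply, LinearMap.smul_apply, smul_eq_mul,
    Matrix.mul_apply, Matrix.transpose_apply, Finset.sum_mul, Finset.mul_sum]
  rw [Finset.sum_comm_cycle]
  refine Finset.sum_congr rfl fun i _ => ?_
  rw [Finset.sum_comm]
  exact Finset.sum_congr rfl fun i _ => Finset.sum_congr rfl fun j _ => by ring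

theorem sum_prod_gram_inv_mul {V ι κ : Type*} [AddCommGroup V] [Module ℝ V] [Fintype ι] [Fintype κ]
    [DecidableEq κ] {b f : ι → V} {Q : Matrix ι ι ℝ} (hf : ∀ i, f i = ∑ a, Q i a • b a)
    (α : MultilinearMap ℝ (fun _ : κ => V) ℝ) :
    ∑ s : κ → ι, ∑ t : κ → ι, (∏ k, (Q.transpose * Q) (s k) (t k)) * α (fun k => b (s k)) *
      α (fun k => b (t k)) = ∑ r : κ → ι, α (fun k => f (r k)) ^ 2 := by
  have hα : ∀ r : κ → ι, α (fun k => f (r k))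
      = ∑ s : κ → ι, (∏ k, Q (r k) (s k)) * α (fun k => b (s k)) := by
    intro r
    simp only [hf]
    rw [α.map_sum]
    exact Finset.sum_congr rfl fun s _ => α.map_smul_univ _ _
  simp only [hα, Matrix.mul_apply, Matrix.transpose_apply, Finset.prod_univ_sum,
    Fintype.piFinset_univ, sq, Finset.sum_mul, Finset.mul_sum, Finset.prod_mul_distrib]
  rw [Finset.sum_comm_cycle]
  refine Finset.sum_congr rfl fun r _ => ?_
  rw [Finset.sum_comm]
  exact Finset.sum_congr rfl fun i _ => Finset.sum_congr rfl fun j _ => by ring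

/-- Cauchy-Schwarz for a linear form evaluated in an orthonormal basis. -/
theorem sq_apply_le_sum_sq_of_orthonormal {V ι : Type*} [AddCommGroup V] [Module ℝ V] [Fintype ι]
    [DecidableEq ι] (f : Module.Basis ι ℝ V) (G : V →ₗ[ℝ] V →ₗ[ℝ] ℝ)
    (horth : ∀ i j, G (f i) (f j) = if i = j then 1 else 0) (l : V →ₗ[ℝ] ℝ) (v : V) :
    l v ^ 2 ≤ G v v * ∑ i, l (f i) ^ 2 := by
  have h1 : G v v = ∑ i, f.repr v i ^ 2 := by
    have : G (∑ i, f.repr v i • f i) (∑ i, f.repr v i • f i) = ∑ i, f.repr v i ^ 2 := by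
      simp only [map_sum, map_smul, LinearMap.sum_apply, LinearMap.smul_apply, horth]
      simp [sq]
    rwa [f.sum_repr] at this
  have h2 : l v = ∑ i, f.repr v i * l (f i) := by
    have : l (∑ i, f.repr v i • f i) = ∑ i, f.repr v i * l (f i) := by
      simp only [map_sum, map_smul, smul_eq_mul]
    rwa [f.sum_repr] at this
  rw [h1, h2]
  exact Finset.sum_mul_sq_le_sq_mul_sq _ _ _

noncomputable section

namespace BalancedGeometry

open Filter Topology

/-! ### Second derivatives and the Levi form -/

section Levi

variable {E : Type*} [NormedAddCommGroup E]

theorem deriv_deriv_line [NormedSpace ℝ E] {f : E → ℝ} {y : E} (hf : ContDiffAt ℝ 2 f y) (v : E) :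
    deriv (deriv fun t : ℝ => f (y + t • v)) 0 = fderiv ℝ (fderiv ℝ f) y v v := by
  have hl : ∀ t : ℝ, HasDerivAt (fun t : ℝ => y + t • v) v t := fun t => by
    simpa using ((hasDerivAt_id t).smul_const v).const_add y
  have hev : ∀ᶠ y' in 𝓝 y, DifferentiableAt ℝ f y' :=
    (hf.eventually (by simp)).mono fun y' h => h.differentiableAt (by simp)
  have hc : Tendsto (fun t : ℝ => y + t • v) (𝓝 0) (𝓝 y) := by
    simpa using (hl 0).continuousAt.tendsto
  have h1 : (deriv fun t : ℝ => f (y + t • v)) =ᶠ[𝓝 0] fun t => fderiv ℝ f (y + t • v) v := by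
    filter_upwards [hc.eventually hev] with t ht
    exact (ht.hasFDerivAt.comp_hasDerivAt t (hl t)).deriv
  have h2 : HasFDerivAt (fderiv ℝ f) (fderiv ℝ (fderiv ℝ f) y) y :=
    ((hf.fderiv_right (m := 1) (by norm_num)).differentiableAt (by simp)).hasFDerivAt
  have h3 : HasFDerivAt (fun y' => fderiv ℝ f y' v) ((fderiv ℝ (fderiv ℝ f) y).flip v)
      (y + (0 : ℝ) • v) := by
    rw [zero_smul, add_zero]
    simpa using h2.clm_apply (hasFDerivAt_const v y)
  rw [h1.deriv_eq]
  exact (h3.comp_hasDerivAt 0 (hl 0)).deriv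

theorem fderiv_fderiv_nonpos_of_isLocalMax [NormedSpace ℝ E] {f : E → ℝ} {y : E}
    (hf : ContDiffAt ℝ 2 f y) (hmax : IsLocalMax f y) (v : E) :
    fderiv ℝ (fderiv ℝ f) y v v ≤ 0 := by
  rw [← deriv_deriv_line hf]
  have hc : ContinuousAt (fun t : ℝ => y + t • v) 0 := by fun_prop
  have hm : IsLocalMax (fun t : ℝ => f (y + t • v)) 0 := by
    have : Tendsto (fun t : ℝ => y + t • v) (𝓝 0) (𝓝 y) := by simpa using hc.tendsto
    filter_upwards [this.eventually hmax] with t ht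
    simpa using ht
  by_contra! hpos
  -- A positive second derivative would make the point a local minimum as well, so the function
  -- would be locally constant along the line and its second derivative zero.
  have hmin : IsLocalMin (fun t : ℝ => f (y + t • v)) 0 :=
    isLocalMin_of_deriv_deriv_pos hpos hm.deriv_eq_zero
      (ContinuousAt.comp (by simpa using hf.continuousAt) hc)
  have hconst : (fun t : ℝ => f (y + t • v)) =ᶠ[𝓝 0] fun _ => f (y + (0 : ℝ) • v) := by
    filter_upwards [hm, hmin] with t h1 h2 using le_antisymm h1 h2
  rw [hconst.deriv.deriv_eq] at hpos
  simp at hpos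

variable [NormedSpace ℂ E]

/-- The Levi form of a function, as a Hermitian quadratic form. -/
def levi (f : E → ℝ) (y v : E) : ℝ :=
  fderiv ℝ (fderiv ℝ f) y v v + fderiv ℝ (fderiv ℝ f) y (Complex.I • v) (Complex.I • v)

theorem levi_nonpos_of_isLocalMax {f : E → ℝ} {y : E} (hf : ContDiffAt ℝ 2 f y)
    (hmax : IsLocalMax f y) (v : E) : levi f y v ≤ 0 :=
  add_nonpos (fderiv_fderiv_nonpos_of_isLocalMax hf hmax _)
    (fderiv_fderiv_nonpos_of_isLocalMax hf hmax _)

theorem levi_const (c : ℝ) (y v : E) : levi (fun _ => c) y v = 0 := by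
  have : fderiv ℝ (fun _ : E => c) = fun _ => 0 := by ext; simp
  simp [levi, this]

theorem levi_neg (f : E → ℝ) (y v : E) : levi (-f) y v = -levi f y v := by
  have h : fderiv ℝ (-f) = -fderiv ℝ f := funext fun _ => fderiv_neg
  simp only [levi, h, fderiv_neg, neg_apply]
  ring

theorem levi_add_const_mul {f h : E → ℝ} {y : E} (hf : ContDiffAt ℝ 2 f y)
    (hh : ContDiffAt ℝ 2 h y) (ε : ℝ) (v : E) :
    levi (fun y => f y + ε * h y) y v = levi f y v + ε * levi h y v := by
  have h1 : fderiv ℝ (fun y => f y + ε * h y) =ᶠ[𝓝 y] fun y => fderiv ℝ f y + ε • fderiv ℝ h y := by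
    filter_upwards [hf.eventually (by simp), hh.eventually (by simp)] with z hz1 hz2
    have h1 := (hz1.differentiableAt (by simp)).hasFDerivAt
    have h2 := (hz2.differentiableAt (by simp)).hasFDerivAt
    exact (h1.add (h2.const_mul ε)).fderiv
  have hf' := ((hf.fderiv_right (m := 1) (by norm_num)).differentiableAt (by simp)).hasFDerivAt
  have hh' := ((hh.fderiv_right (m := 1) (by norm_num)).differentiableAt (by simp)).hasFDerivAt
  have h2 : fderiv ℝ (fderiv ℝ fun y => f y + ε * h y) y
      = fderiv ℝ (fderiv ℝ f) y + ε • fderiv ℝ (fderiv ℝ h) y := by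
    rw [h1.fderiv_eq]
    exact (hf'.add (hh'.const_smul ε)).fderiv
  simp only [levi, h2, add_apply, smul_apply, smul_eq_mul]
  ring

/-- The Levi form is invariant under holomorphic maps. -/
theorem levi_comp {h : E → ℝ} {ψ : E → E} {y : E} (hh : ContDiffAt ℝ 2 h (ψ y))
    (hψ : ContDiffAt ℂ 2 ψ y) (v : E) :
    levi (h ∘ ψ) y v = levi h (ψ y) (fderiv ℝ ψ y v) := by
  have hψe : ∀ᶠ z in 𝓝 y, DifferentiableAt ℂ ψ z :=
    (hψ.eventually (by simp)).mono fun z hz => hz.differentiableAt (by simp)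
  have hhe : ∀ᶠ z in 𝓝 y, DifferentiableAt ℝ h (ψ z) :=
    (hψ.continuousAt.eventually (hh.eventually (by simp))).mono
      fun z hz => hz.differentiableAt (by simp)
  have h1 : fderiv ℝ (h ∘ ψ) =ᶠ[𝓝 y]
      fun z => (fderiv ℝ h (ψ z)).comp ((fderiv ℂ ψ z).restrictScalars ℝ) := by
    filter_upwards [hψe, hhe] with z hz1 hz2
    exact (hz2.hasFDerivAt.comp z (hz1.hasFDerivAt.restrictScalars ℝ)).fderiv
  have hψ0 := (hψ.differentiableAt (by simp)).hasFDerivAt.restrictScalars ℝ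
  have hh' : HasFDerivAt (fderiv ℝ h) (fderiv ℝ (fderiv ℝ h) (ψ y)) (ψ y) :=
    ((hh.fderiv_right (m := 1) (by norm_num)).differentiableAt (by simp)).hasFDerivAt
  have hψ' : HasFDerivAt (fderiv ℂ ψ) ((fderiv ℂ (fderiv ℂ ψ) y).restrictScalars ℝ) y :=
    ((hψ.fderiv_right (m := 1) (by norm_num)).differentiableAt
      (by simp)).hasFDerivAt.restrictScalars ℝ
  have hψ'' := (ContinuousLinearMap.restrictScalarsL ℂ E E ℝ ℝ).hasFDerivAt.comp y hψ'
  have h2 := (hh'.comp y hψ0).clm_comp hψ''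
  -- Second-order chain rule. Its last term is the obstruction to invariance. It cancels between `v`
  -- and `i v` because the second derivative of `ψ` is complex bilinear.
  have h3 : ∀ w, fderiv ℝ (fderiv ℝ (h ∘ ψ)) y w w
      = fderiv ℝ (fderiv ℝ h) (ψ y) (fderiv ℂ ψ y w) (fderiv ℂ ψ y w)
        + fderiv ℝ h (ψ y) (fderiv ℂ (fderiv ℂ ψ) y w w) := by
    intro w
    rw [h1.fderiv_eq]
    refine (congrArg (fun T : E →L[ℝ] E →L[ℝ] ℝ => T w w) h2.fderiv).trans ?_
    simp [add_comm]
  rw [levi, levi, h3, h3, hψ0.fderiv]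
  have hI : Complex.I • Complex.I • fderiv ℂ (fderiv ℂ ψ) y v v
      = - fderiv ℂ (fderiv ℂ ψ) y v v := by
    rw [smul_smul, Complex.I_mul_I, neg_one_smul]
  simp only [map_smul, smul_apply, hI, map_neg,
    ContinuousLinearMap.coe_restrictScalars']
  ring

/-- The barrier restricted to a real line is a quadratic polynomial. The term with `N` supplies
positivity in the direction `n`, to outweigh the fixed negative term. -/
theorem levi_barrier {F : Type*} [NormedAddCommGroup F] [InnerProductSpace ℝ F] (T : E →L[ℝ] F)
    (z n : F) (N : ℝ) (y v : E) :
    levi (fun y => inner ℝ n (T y - z) + N * inner ℝ n (T y - z) ^ 2 - ‖T y - z‖ ^ 2) y v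
      = 2 * N * (inner ℝ n (T v) ^ 2 + inner ℝ n (T (Complex.I • v)) ^ 2)
        - 2 * (‖T v‖ ^ 2 + ‖T (Complex.I • v)‖ ^ 2) := by
  set h := fun y => inner ℝ n (T y - z) + N * inner ℝ n (T y - z) ^ 2 - ‖T y - z‖ ^ 2
  have hh : ContDiff ℝ 2 h := by
    have h1 : ContDiff ℝ 2 fun y => T y - z := T.contDiff.sub contDiff_const
    have h2 := (contDiff_const (c := n)).inner ℝ h1
    exact (h2.add (contDiff_const.mul (h2.pow 2))).sub (h1.norm_sq ℝ)
  have key : ∀ w, fderiv ℝ (fderiv ℝ h) y w w = 2 * N * inner ℝ n (T w) ^ 2 - 2 * ‖T w‖ ^ 2 := by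
    intro w
    rw [← deriv_deriv_line hh.contDiffAt]
    obtain ⟨a, b, hab⟩ : ∃ a b : ℝ, (fun t : ℝ => h (y + t • w))
        = fun t => a + b * t + (N * inner ℝ n (T w) ^ 2 - ‖T w‖ ^ 2) * t ^ 2 := by
      refine ⟨h y, inner ℝ n (T w) + 2 * N * inner ℝ n (T y - z) * inner ℝ n (T w)
        - 2 * inner ℝ (T y - z) (T w), ?_⟩
      ext t
      have : T (y + t • w) - z = (T y - z) + t • T w := by
        rw [map_add, map_smul]; abel
      simp only [h, this, inner_add_right, inner_smul_right, norm_add_sq_real, norm_smul, mul_pow,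
        Real.norm_eq_abs, sq_abs]
      ring
    have hd : deriv (fun t : ℝ => h (y + t • w))
        = fun t => b + (N * inner ℝ n (T w) ^ 2 - ‖T w‖ ^ 2) * (2 * t) := by
      rw [hab]
      ext t
      have := (((hasDerivAt_id t).const_mul b).const_add a).add
        (((hasDerivAt_id t).pow 2).const_mul (N * inner ℝ n (T w) ^ 2 - ‖T w‖ ^ 2))
      exact this.deriv.trans (by simp)
    have hd2 := (((hasDerivAt_id (0 : ℝ)).const_mul 2).const_mul
      (N * inner ℝ n (T w) ^ 2 - ‖T w‖ ^ 2)).const_add b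
    rw [hd]
    exact hd2.deriv.trans (by ring)
  rw [levi, key, key]
  ring

end Levi

/-! ### The Laplacian and norms in the preferred chart -/

section Manifold

variable {E : Type*} [NormedAddCommGroup E] [NormedSpace ℂ E]
  {X : Type*} [TopologicalSpace X] [ChartedSpace E X]

theorem hasMFDerivAt_real {f : E → X} {y : E} {D : E →L[ℂ] E}
    (hf : HasMFDerivAt 𝓘(ℂ, E) 𝓘(ℂ, E) f y D) :
    HasMFDerivAt 𝓘(ℝ, E) 𝓘(ℝ, E) f y (D.restrictScalars ℝ : E →L[ℝ] E) :=
  ⟨hf.1, hf.2.restrictScalars ℝ⟩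

theorem contDiffAt_chart_comp [IsManifold 𝓘(ℂ, E) ω X] {x₀ x : X}
    (hx : x ∈ (chartAt E x₀).source) :
    ContDiffAt ℂ 2 (extChartAt 𝓘(ℝ, E) x₀ ∘ (extChartAt 𝓘(ℝ, E) x).symm)
      (extChartAt 𝓘(ℝ, E) x x) := by
  have h := contDiffWithinAt_ext_coord_change (I := 𝓘(ℂ, E)) (n := ω) x₀ x
    (y := extChartAt 𝓘(ℂ, E) x x) (by
      rw [PartialEquiv.trans_source]
      refine ⟨mem_extChartAt_target x, ?_⟩
      simpa using hx)
  rw [modelWithCornersSelf_coe, Set.range_id, contDiffWithinAt_univ] at h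
  exact h.of_le le_top

variable [IsManifold 𝓘(ℂ, E) ω X]

theorem contDiffAt_comp_chart_symm {u : X → ℝ} (hu : ContMDiff 𝓘(ℝ, E) 𝓘(ℝ, ℝ) 2 u) (x : X)
    {y : E} (hy : y ∈ (extChartAt 𝓘(ℝ, E) x).target) :
    ContDiffAt ℝ 2 (u ∘ (extChartAt 𝓘(ℝ, E) x).symm) y := by
  have h1 : ContMDiffAt 𝓘(ℝ, E) 𝓘(ℝ, E) 2 (extChartAt 𝓘(ℝ, E) x).symm y :=
    (contMDiffOn_extChartAt_symm x).contMDiffAt ((isOpen_extChartAt_target x).mem_nhds hy)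
  exact contMDiffAt_iff_contDiffAt.1 (hu.contMDiffAt.comp y h1)

theorem dc_inChart {u : X → ℝ} (hu : ContMDiff 𝓘(ℝ, E) 𝓘(ℝ, ℝ) 2 u) (x : X)
    {y : E} (hy : y ∈ (extChartAt 𝓘(ℝ, E) x).target) (v : Fin 1 → E) :
    (dc (E := E) u).inChart x y v
      = -(fderiv ℝ (u ∘ (extChartAt 𝓘(ℝ, E) x).symm) y (Complex.I • v 0)) := by
  obtain ⟨D, hD⟩ : ∃ D : E →L[ℂ] E, HasMFDerivAt 𝓘(ℂ, E) 𝓘(ℂ, E) (extChartAt 𝓘(ℝ, E) x).symm y D :=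
    have h1 : ContMDiffAt 𝓘(ℂ, E) 𝓘(ℂ, E) 2 (extChartAt 𝓘(ℂ, E) x).symm y :=
      (contMDiffOn_extChartAt_symm x).contMDiffAt ((isOpen_extChartAt_target x).mem_nhds hy)
    ⟨_, (h1.mdifferentiableAt (by simp)).hasMFDerivAt⟩
  have hR := hasMFDerivAt_real hD
  have hu' : MDifferentiableAt 𝓘(ℝ, E) 𝓘(ℝ, ℝ) u ((extChartAt 𝓘(ℝ, E) x).symm y) :=
    hu.contMDiffAt.mdifferentiableAt (by simp)
  let du : E →L[ℝ] ℝ := mfderiv 𝓘(ℝ, E) 𝓘(ℝ, ℝ) u ((extChartAt 𝓘(ℝ, E) x).symm y)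
  have hc : fderiv ℝ (u ∘ (extChartAt 𝓘(ℝ, E) x).symm) y = du.comp (D.restrictScalars ℝ) := by
    rw [← mfderiv_eq_fderiv]
    exact (hu'.hasMFDerivAt.comp y hR).mfderiv
  rw [hc, Form.inChart, hR.mfderiv]
  -- The inverse chart is holomorphic, so its derivative `D` commutes with the complex structure.
  change -(du (Complex.I • D (v 0))) = -(du (D (Complex.I • v 0)))
  rw [D.map_smul]

/-- In the chart `dᶜu` is a constant linear operator `S` applied to the derivative of `u`, so `d
dᶜu` involves second derivatives only. For `v = w` the right side is half the Levi form. -/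
theorem iddbar_apply {u : X → ℝ} (hu : ContMDiff 𝓘(ℝ, E) 𝓘(ℝ, ℝ) 2 u) (x : X) (v w : E) :
    iddbar (E := E) u x ![v, (Complex.I • w : E)] = (1 / 2 : ℝ) *
      (fderiv ℝ (fderiv ℝ (u ∘ (extChartAt 𝓘(ℝ, E) x).symm)) (extChartAt 𝓘(ℝ, E) x x) v w
      + fderiv ℝ (fderiv ℝ (u ∘ (extChartAt 𝓘(ℝ, E) x).symm)) (extChartAt 𝓘(ℝ, E) x x)
        (Complex.I • w) (Complex.I • v)) := by
  set f := u ∘ (extChartAt 𝓘(ℝ, E) x).symm with hf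
  set y₀ := extChartAt 𝓘(ℝ, E) x x with hy₀
  have hf2 : ContDiffAt ℝ 2 f y₀ := contDiffAt_comp_chart_symm hu x (mem_extChartAt_target x)
  have hD : HasFDerivAt (fderiv ℝ f) (fderiv ℝ (fderiv ℝ f) y₀) y₀ :=
    ((hf2.fderiv_right (m := 1) (by norm_num)).differentiableAt (by simp)).hasFDerivAt
  let J : E →L[ℝ] E := Complex.I • ContinuousLinearMap.id ℝ E
  let S : (E →L[ℝ] ℝ) →L[ℝ] (E [⋀^Fin 1]→L[ℝ] ℝ) :=
    ((ContinuousAlternatingMap.ofSubsingletonLIE (𝕜 := ℝ) (E := E) (F := ℝ)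
      (0 : Fin 1)).toContinuousLinearEquiv : (E →L[ℝ] ℝ) →L[ℝ] (E [⋀^Fin 1]→L[ℝ] ℝ)).comp
      (-((ContinuousLinearMap.compL ℝ E E ℝ).flip J))
  have hS : ∀ (l : E →L[ℝ] ℝ) (v : Fin 1 → E), S l v = -(l (Complex.I • v 0)) := fun l v => rfl
  have hev : (dc (E := E) u).inChart x =ᶠ[𝓝 y₀] fun y => S (fderiv ℝ f y) := by
    filter_upwards [(isOpen_extChartAt_target x).mem_nhds (mem_extChartAt_target x)] with y hy
    ext v
    rw [dc_inChart hu x hy, hS]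
  have hd : fderiv ℝ ((dc (E := E) u).inChart x) y₀ = S.comp (fderiv ℝ (fderiv ℝ f) y₀) := by
    rw [hev.fderiv_eq]
    exact (S.hasFDerivAt.comp y₀ hD).fderiv
  have h1 : ∀ v w : E, (dc (E := E) u).d x ![v, w]
      = -(fderiv ℝ (fderiv ℝ f) y₀ v (Complex.I • w))
        + fderiv ℝ (fderiv ℝ f) y₀ w (Complex.I • v) := by
    intro v w
    change extDeriv ((dc (E := E) u).inChart x) y₀ ![v, w] = _
    rw [extDeriv, hd, ContinuousAlternatingMap.alternatizeUncurryFin_apply]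
    simp [Fin.sum_univ_two, hS]
    exact add_comm _ _
  have hI : Complex.I • Complex.I • w = -w := by rw [smul_smul, Complex.I_mul_I, neg_one_smul]
  change (1 / 2 : ℝ) * (dc (E := E) u).d x ![v, (Complex.I • w : E)] = _
  rw [h1, hI, map_neg, neg_neg]

namespace HermitianMetric

variable (g : HermitianMetric E X) [FiniteDimensional ℂ E]

/-- The metric at a point, as a bilinear form. -/
def bilin (x : X) : E →ₗ[ℝ] E →ₗ[ℝ] ℝ :=
  LinearMap.mk₂ ℝ (fun v w : E => g.inner x v w) (fun v v' w => by
    have := congrArg (fun T => T w) ((g.inner x).map_add v v')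
    exact this) (fun c v w => by
    have := congrArg (fun T => T w) ((g.inner x).map_smul c v)
    exact this) (fun v w w' => (g.inner x v).map_add w w') (fun c v w => (g.inner x v).map_smul c w)

/-- Around each point, traces and norms can be computed in an orthonormal basis. -/
theorem exists_orthonormal_basis (x : X) :
    ∃ f : Module.Basis (Fin (Module.finrank ℝ E)) ℝ E,
      (∀ i j, g.bilin x (f i) (f j) = if i = j then 1 else 0) ∧
      (∀ u : X → ℝ, ContMDiff 𝓘(ℝ, E) 𝓘(ℝ, ℝ) 2 u → g.laplacian u x = (1 / 4 : ℝ) *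
        ∑ i, levi (u ∘ (extChartAt 𝓘(ℝ, E) x).symm) (extChartAt 𝓘(ℝ, E) x x) (f i)) ∧
      ∀ (k : ℕ) (α : Form E X k), g.normSq α x = (k.factorial : ℝ)⁻¹ *
        ∑ s : Fin k → Fin (Module.finrank ℝ E), (α x (fun t => f (s t)) : ℝ) ^ 2 := by
  obtain ⟨f, Q, hf, hQ, horth⟩ := exists_orthonormal_basis_of_gram (Module.finBasis ℝ E)
    (g.bilin x) (fun v w => g.symm x v w) (fun v hv => g.pos x v hv)
  have hQ' : (g.gram x)⁻¹ = Q.transpose * Q := hQ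
  refine ⟨f, horth, fun u hu => ?_, fun k α => ?_⟩
  · set D := fderiv ℝ (fderiv ℝ (u ∘ (extChartAt 𝓘(ℝ, E) x).symm)) (extChartAt 𝓘(ℝ, E) x x)
      with hD
    -- A bilinear form with the Levi form on its diagonal. The factor `1/4` is the `1/2` of `trace`
    -- times the `1/2` of `iddbar`.
    let B : E →ₗ[ℝ] E →ₗ[ℝ] ℝ := LinearMap.mk₂ ℝ
      (fun v w : E => D v w + D (Complex.I • w) (Complex.I • v))
      (by intros; simp only [smul_add, map_add, add_apply]; ring)
      (by intros; simp only [smul_comm Complex.I, map_smul, smul_apply, smul_eq_mul]; ring)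
      (by intros; simp only [smul_add, map_add, add_apply]; ring)
      (by intros; simp only [smul_comm Complex.I, map_smul, smul_apply, smul_eq_mul]; ring)
    have hB := sum_gram_inv_mul hf B
    have hlevi : ∀ v, levi (u ∘ (extChartAt 𝓘(ℝ, E) x).symm) (extChartAt 𝓘(ℝ, E) x x) v
      = B v v := fun v => rfl
    simp only [hlevi]
    rw [← hB, laplacian, trace, hQ', Finset.mul_sum, Finset.mul_sum]
    refine Finset.sum_congr rfl fun a _ => ?_
    rw [Finset.mul_sum, Finset.mul_sum]
    refine Finset.sum_congr rfl fun b _ => ?_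
    have := iddbar_apply hu x (Module.finBasis ℝ E a) (Module.finBasis ℝ E b)
    have h2 : iddbar (E := E) u x ![frame E x a, cplx x (frame E x b)]
      = (1 / 2 : ℝ) * B (Module.finBasis ℝ E a) (Module.finBasis ℝ E b) := this
    rw [h2]
    ring
  · rw [normSq, hQ']
    congr 1
    exact sum_prod_gram_inv_mul hf (α x).toMultilinearMap

theorem normSq_nonneg {k : ℕ} (α : Form E X k) (x : X) : 0 ≤ g.normSq α x := by
  obtain ⟨f, -, -, h⟩ := g.exists_orthonormal_basis x
  rw [h]
  positivity

theorem eq_zero_of_normSq_eq_zero {k : ℕ} {α : Form E X k} {x : X} (h0 : g.normSq α x = 0) :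
    α x = 0 := by
  obtain ⟨f, -, -, h⟩ := g.exists_orthonormal_basis x
  rw [h, mul_eq_zero, Finset.sum_eq_zero_iff_of_nonneg fun _ _ => sq_nonneg _] at h0
  have h1 := h0.resolve_left (by positivity)
  refine ContinuousAlternatingMap.toAlternatingMap_injective ?_
  refine Module.Basis.ext_alternating (N₁ := E) f fun s _ => ?_
  exact pow_eq_zero_iff (two_ne_zero) |>.1 (h1 s (Finset.mem_univ _))

end HermitianMetric

end Manifold

/-! ### Comparison of the metric with a fixed chart -/

variable {E : Type*} [NormedAddCommGroup E] [NormedSpace ℂ E]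
  {X : Type*} [TopologicalSpace X] [ChartedSpace E X] [IsManifold 𝓘(ℂ, E) ω X]

namespace HermitianMetric

variable (g : HermitianMetric E X)

open Bundle in
/-- Locally, the metric is comparable with the norm of the model space, through a fixed chart. -/
theorem eventually_chart_bounds (x₀ : X) : ∃ C : ℝ, 0 < C ∧ ∀ᶠ x in 𝓝 x₀,
    (∀ v : E, ‖fderiv ℝ (extChartAt 𝓘(ℝ, E) x₀ ∘ (extChartAt 𝓘(ℝ, E) x).symm)
      (extChartAt 𝓘(ℝ, E) x x) v‖ ^ 2 ≤ C * g.bilin x v v) ∧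
    ∀ w : E, ∃ v : E, fderiv ℝ (extChartAt 𝓘(ℝ, E) x₀ ∘ (extChartAt 𝓘(ℝ, E) x).symm)
      (extChartAt 𝓘(ℝ, E) x x) v = w ∧ g.bilin x v v ≤ C * ‖w‖ ^ 2 := by
  let : RiemannianBundle (fun x : X => TangentSpace 𝓘(ℝ, E) x) := ⟨g.toRiemannianMetric⟩
  have : IsManifold 𝓘(ℝ, E) 1 X := IsManifold.of_le (n := ω) le_top
  have : IsContinuousRiemannianBundle E (fun x : X => TangentSpace 𝓘(ℝ, E) x) :=
    ⟨⟨g.inner, g.contMDiff.continuous, fun _ _ _ => rfl⟩⟩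
  obtain ⟨C₁, hC₁, h₁⟩ :=
    eventually_norm_trivializationAt_lt E (fun x : X => TangentSpace 𝓘(ℝ, E) x) x₀
  obtain ⟨C₂, hC₂, h₂⟩ :=
    eventually_norm_symmL_trivializationAt_lt E (fun x : X => TangentSpace 𝓘(ℝ, E) x) x₀
  refine ⟨C₁ ^ 2 + C₂ ^ 2, by positivity, ?_⟩
  filter_upwards [h₁, h₂, chart_source_mem_nhds E x₀] with x hx₁ hx₂ hxs
  have hb : x ∈ (trivializationAt E (fun x : X => TangentSpace 𝓘(ℝ, E) x) x₀).baseSet := by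
    simpa using hxs
  have hn : ∀ v : TangentSpace 𝓘(ℝ, E) x, ‖v‖ ^ 2 = g.bilin x v v := fun v =>
    (real_inner_self_eq_norm_sq v).symm
  set T := (trivializationAt E (fun x : X => TangentSpace 𝓘(ℝ, E) x) x₀).continuousLinearMapAt ℝ x
    with hT
  set S := (trivializationAt E (fun x : X => TangentSpace 𝓘(ℝ, E) x) x₀).symmL ℝ x
  -- The derivative of the transition map is the tangent trivialization, whose norm and inverse norm
  -- are bounded near `x₀` by `C₁` and `C₂`.
  have hTd : ∀ v : E, fderiv ℝ (extChartAt 𝓘(ℝ, E) x₀ ∘ (extChartAt 𝓘(ℝ, E) x).symm)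
      (extChartAt 𝓘(ℝ, E) x x) v = T v := by
    intro v
    rw [hT, TangentBundle.continuousLinearMapAt_trivializationAt_eq_core hxs]
    change _ = tangentCoordChange 𝓘(ℝ, E) x x₀ x v
    rw [tangentCoordChange_def, modelWithCornersSelf_coe, Set.range_id, fderivWithin_univ]
  have hTS : ∀ w : E, T (S w) = w := fun w =>
    (trivializationAt E (fun x : X => TangentSpace 𝓘(ℝ, E) x) x₀).continuousLinearMapAt_symmL hb w
  refine ⟨fun v => ?_, fun w => ⟨S w, (hTd _).trans (hTS w), ?_⟩⟩
  · rw [hTd]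
    have h := (T.le_opNorm v).trans (mul_le_mul_of_nonneg_right hx₁.le (norm_nonneg _))
    have h2 := hn v
    have h3 := pow_le_pow_left₀ (norm_nonneg _) h 2
    rw [mul_pow, h2] at h3
    have h4 : 0 ≤ g.bilin x v v := h2 ▸ sq_nonneg _
    nlinarith [mul_nonneg (sq_nonneg C₂) h4]
  · have h := (S.le_opNorm w).trans (mul_le_mul_of_nonneg_right hx₂.le (norm_nonneg _))
    have h2 := hn (S w)
    calc g.bilin x (S w) (S w) = ‖S w‖ ^ 2 := h2.symm
      _ ≤ (C₂ * ‖w‖) ^ 2 := by gcongr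
      _ = C₂ ^ 2 * ‖w‖ ^ 2 := by ring
      _ ≤ _ := by nlinarith [sq_nonneg C₁, sq_nonneg (‖w‖ * C₁)]

end HermitianMetric

/-! ### The strong maximum principle on the manifold and the kernel of `L` -/

variable {E : Type*} [NormedAddCommGroup E] [NormedSpace ℂ E]
  {X : Type*} [TopologicalSpace X] [ChartedSpace E X] [IsManifold 𝓘(ℂ, E) ω X]

namespace HermitianMetric

variable (g : HermitianMetric E X) [FiniteDimensional ℂ E]

/-- The strong maximum principle for the Chern Laplacian. -/
theorem eventually_eq_of_laplacian_nonneg {u : X → ℝ} (hu : ContMDiff 𝓘(ℝ, E) 𝓘(ℝ, ℝ) 2 u)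
    {x₀ : X} (hmax : ∀ x, u x ≤ u x₀) (hlap : ∀ᶠ x in 𝓝 x₀, 0 ≤ g.laplacian u x) :
    ∀ᶠ x in 𝓝 x₀, u x = u x₀ := by
  obtain ⟨C, hC, hbd⟩ := g.eventually_chart_bounds x₀
  set φ := extChartAt 𝓘(ℝ, E) x₀ with hφ
  -- The barrier needs an inner product, which the norm of `E` need not come from.
  let e := toEuclidean (E := E)
  let eL : E →L[ℝ] EuclideanSpace ℝ (Fin (Module.finrank ℝ E)) := e
  have hsrc : ∀ᶠ x in 𝓝 x₀, x ∈ φ.source := extChartAt_source_mem_nhds x₀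
  have hgood := (hlap.and (hbd.and hsrc)).eventually_nhds
  have hsymm : ∀ {y}, e.symm y ∈ φ.target → ContinuousAt (fun y => φ.symm (e.symm y)) y :=
    fun hy => ContinuousAt.comp (continuousAt_extChartAt_symm'' hy)
      e.symm.continuous.continuousAt
  have htgt : ∀ {y}, e.symm y ∈ φ.target → ∀ᶠ y' in 𝓝 y, e.symm y' ∈ φ.target := fun {y} hy =>
    e.symm.continuous.continuousAt.eventually ((isOpen_extChartAt_target x₀).mem_nhds hy)
  have hp : e.symm (e (φ x₀)) ∈ φ.target := by
    rw [e.symm_apply_apply]; exact mem_extChartAt_target x₀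
  have hpx : φ.symm (e.symm (e (φ x₀))) = x₀ := by
    rw [e.symm_apply_apply]; exact extChartAt_to_inv x₀
  have key : ∀ᶠ y in 𝓝 (e (φ x₀)), u (φ.symm (e.symm y)) = u x₀ := by
    have hU := (htgt hp).and ((hsymm hp).tendsto.eventually (hpx.symm ▸ hgood))
    refine eventually_eq_of_barrier hU
      (fun y hy => (hu.continuous.continuousAt.comp (hsymm hy.1)).continuousWithinAt)
      (fun y _ => hmax _) (by rw [hpx]) ?_
    rintro z ⟨hzt, hz⟩ - n hn
    -- Summed over an orthonormal basis, the negative part of the barrier's Levi form is at most `2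
    -- * B`, while its positive part is at least `2 * N * I₁` with `I₁ ≥ ‖n‖ ^ 4 / (C * ‖e.symm n‖ ^
    -- 2)`. The choice of `N` gives `N * I₁ ≥ B + 1`.
    set B : ℝ := Module.finrank ℝ E * (2 * (‖eL‖ ^ 2 * C)) with hB
    have hB0 : 0 ≤ B := by positivity
    have hn' : 0 < ‖n‖ := norm_pos_iff.2 hn
    have hen : 0 < ‖e.symm n‖ := norm_pos_iff.2 (by simpa using hn)
    refine ⟨(B + 1) * (C * ‖e.symm n‖ ^ 2) / ‖n‖ ^ 4, by positivity, ?_⟩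
    set N := (B + 1) * (C * ‖e.symm n‖ ^ 2) / ‖n‖ ^ 4 with hN
    filter_upwards [htgt hzt, (hsymm hzt).eventually hz]
      with y hyt ⟨hlapx, ⟨hT1, hT2⟩, hxs⟩ ε hε hloc
    set x := φ.symm (e.symm y) with hx
    set φx := extChartAt 𝓘(ℝ, E) x with hφx
    set T := fderiv ℝ (φ ∘ φx.symm) (φx x)
    have hψ : ContDiffAt ℂ 2 (φ ∘ φx.symm) (φx x) :=
      contDiffAt_chart_comp (by simpa [hφ] using hxs)
    have hψx : (φ ∘ φx.symm) (φx x) = e.symm y := by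
      simp only [Function.comp_apply, hφx, extChartAt_to_inv]
      exact φ.right_inv hyt
    set h : E → ℝ := fun y => inner ℝ n (e y - z) + N * inner ℝ n (e y - z) ^ 2 - ‖e y - z‖ ^ 2
      with hh
    have hhc : ContDiff ℝ 2 h := by
      have h1 : ContDiff ℝ 2 fun y => e y - z := e.contDiff.sub contDiff_const
      have h2 := (contDiff_const (c := n)).inner ℝ h1
      exact (h2.add (contDiff_const.mul (h2.pow 2))).sub (h1.norm_sq ℝ)
    have hfu : ContDiffAt ℝ 2 (u ∘ φx.symm) (φx x) :=
      contDiffAt_comp_chart_symm hu x (mem_extChartAt_target x)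
    have hhψ : ContDiffAt ℝ 2 (h ∘ (φ ∘ φx.symm)) (φx x) :=
      hhc.contDiffAt.comp _ (hψ.restrict_scalars ℝ)
    -- The local maximum is moved to the preferred chart at `x`, where the Laplacian at `x` is
    -- computed.
    have hloc' : IsLocalMax (fun y => (u ∘ φx.symm) y + ε * (h ∘ (φ ∘ φx.symm)) y) (φx x) := by
      have hc : Tendsto (fun y => e ((φ ∘ φx.symm) y)) (𝓝 (φx x)) (𝓝 y) := by
        have := (e.continuous.continuousAt (x := (φ ∘ φx.symm) (φx x))).comp hψ.continuousAt
        have h2 : e ((φ ∘ φx.symm) (φx x)) = y := by rw [hψx, e.apply_symm_apply]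
        rw [ContinuousAt, Function.comp_apply, h2] at this
        exact this
      have hs : ∀ᶠ y' in 𝓝 (φx x), φx.symm y' ∈ φ.source := by
        have h1 : ContinuousAt φx.symm (φx x) := continuousAt_extChartAt_symm x
        refine h1.eventually ((isOpen_extChartAt_source x₀).mem_nhds ?_)
        rw [hφx, extChartAt_to_inv]
        exact hxs
      filter_upwards [hc.eventually hloc, hs] with y' hy' hys
      have h1 : u (φ.symm (e.symm (e ((φ ∘ φx.symm) y')))) = (u ∘ φx.symm) y' := by
        rw [e.symm_apply_apply, Function.comp_apply, φ.left_inv hys, Function.comp_apply]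
      have h2 : (u ∘ φx.symm) (φx x) = u (φ.symm (e.symm y)) := by
        rw [Function.comp_apply, hφx, extChartAt_to_inv]
      have h3 : (h ∘ (φ ∘ φx.symm)) (φx x) = h (e.symm y) := by
        rw [Function.comp_apply, hψx]
      simp only [h1] at hy'
      rw [h2, h3]
      simp only [hh, e.apply_symm_apply]
      exact hy'
    obtain ⟨f, horth, hlapl, -⟩ := g.exists_orthonormal_basis x
    have hlevi : ∀ i, levi (u ∘ φx.symm) (φx x) (f i)
        + ε * levi h ((φ ∘ φx.symm) (φx x)) (T (f i)) ≤ 0 := by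
      intro i
      have := levi_nonpos_of_isLocalMax (hfu.add (contDiffAt_const.mul hhψ)) hloc' (f i)
      rwa [levi_add_const_mul hfu hhψ, levi_comp hhc.contDiffAt hψ] at this
    have hsum := Finset.sum_nonpos fun i (_ : i ∈ Finset.univ) => hlevi i
    rw [Finset.sum_add_distrib, ← Finset.mul_sum] at hsum
    rw [hlapl u hu] at hlapx
    set I₁ := ∑ i, inner ℝ n (e (T (f i))) ^ 2 with hI₁
    -- Cauchy-Schwarz for the form `inner ℝ n (e (T ·))` at a controlled preimage `v` of `e.symm n`,
    -- where its value is `‖n‖ ^ 2`.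
    have hlow : ‖n‖ ^ 4 ≤ (C * ‖e.symm n‖ ^ 2) * I₁ := by
      obtain ⟨v, hv, hvC⟩ := hT2 (e.symm n)
      let l : E →ₗ[ℝ] ℝ := ((innerSL ℝ n).comp (eL.comp T)).toLinearMap
      have hl := sq_apply_le_sum_sq_of_orthonormal f (g.bilin x) horth l v
      have hlv : l v = ‖n‖ ^ 2 := by
        change inner ℝ n (e (T v)) = _
        rw [show T v = e.symm n from hv, e.apply_symm_apply, real_inner_self_eq_norm_sq]
      have hli : ∑ i, l (f i) ^ 2 = I₁ := rfl
      rw [hlv, hli] at hl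
      have : 0 ≤ I₁ := Finset.sum_nonneg fun _ _ => sq_nonneg _
      calc ‖n‖ ^ 4 = (‖n‖ ^ 2) ^ 2 := by ring
        _ ≤ _ := hl.trans (by gcongr)
    have hbar : ∀ i, 2 * N * inner ℝ n (e (T (f i))) ^ 2 - 2 * (2 * (‖eL‖ ^ 2 * C))
        ≤ levi h ((φ ∘ φx.symm) (φx x)) (T (f i)) := by
      intro i
      have hop : ∀ w : E, ‖w‖ = ‖T (f i)‖ → ‖e w‖ ^ 2 ≤ ‖eL‖ ^ 2 * C := by
        intro w hw
        have h1 : ‖e w‖ ≤ ‖eL‖ * ‖w‖ := eL.le_opNorm w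
        have h2 : ‖w‖ ^ 2 ≤ C := by
          have := hT1 (f i)
          rw [horth, if_pos rfl, mul_one] at this
          rwa [hw]
        calc ‖e w‖ ^ 2 ≤ (‖eL‖ * ‖w‖) ^ 2 := by gcongr
          _ = ‖eL‖ ^ 2 * ‖w‖ ^ 2 := by ring
          _ ≤ _ := by gcongr
      have h1 := hop _ rfl
      have h2 := hop (Complex.I • T (f i)) (by simp [norm_smul])
      have h3 := levi_barrier eL z n N ((φ ∘ φx.symm) (φx x)) (T (f i))
      have hN0 : 0 ≤ N := by positivity
      have h4 := mul_nonneg hN0 (sq_nonneg (inner ℝ n (e (Complex.I • T (f i)))))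
      refine le_trans ?_ h3.ge
      change _ ≤ 2 * N * (inner ℝ n (e (T (f i))) ^ 2
        + inner ℝ n (e (Complex.I • T (f i))) ^ 2)
        - 2 * (‖e (T (f i))‖ ^ 2 + ‖e (Complex.I • T (f i))‖ ^ 2)
      linarith
    have hbars := Finset.sum_le_sum fun i (_ : i ∈ Finset.univ) => hbar i
    rw [Finset.sum_sub_distrib, ← Finset.mul_sum, Finset.sum_const, Finset.card_univ,
      Fintype.card_fin, nsmul_eq_mul, ← hI₁] at hbars
    have hNI : B + 1 ≤ N * I₁ := by
      rw [hN, div_mul_eq_mul_div, le_div_iff₀ (by positivity), mul_assoc]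
      exact mul_le_mul_of_nonneg_left hlow (by positivity)
    -- The barrier sum is strictly positive and the Laplacian of `u` nonnegative, while `hsum` says
    -- that their combination is nonpositive.
    have hpos : 0 < ∑ i, levi h ((φ ∘ φx.symm) (φx x)) (T (f i)) := by
      refine lt_of_lt_of_le ?_ hbars
      linarith
    have := mul_pos hε hpos
    linarith
  have hc : ContinuousAt (fun x => e (φ x)) x₀ :=
    e.continuous.continuousAt.comp (continuousAt_extChartAt x₀)
  filter_upwards [hc.eventually key, hsrc] with x hx hxs
  rwa [e.symm_apply_apply, φ.left_inv hxs] at hx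

theorem laplacian_const (a : ℝ) (x : X) : g.laplacian (fun _ => a) x = 0 := by
  obtain ⟨f, -, h, -⟩ := g.exists_orthonormal_basis x
  rw [h _ contMDiff_const]
  exact mul_eq_zero_of_right _ (Finset.sum_eq_zero fun i _ => levi_const a _ _)

theorem laplacian_neg {u : X → ℝ} (hu : ContMDiff 𝓘(ℝ, E) 𝓘(ℝ, ℝ) 2 u) (x : X) :
    g.laplacian (-u) x = -g.laplacian u x := by
  obtain ⟨f, -, h, -⟩ := g.exists_orthonormal_basis x
  rw [h (-u) hu.neg, h u hu, ← mul_neg, ← Finset.sum_neg_distrib]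
  exact congrArg _ (Finset.sum_congr rfl fun i _ => levi_neg _ _ _)

theorem L_eq_zero_iff (hn : 2 ≤ Module.finrank ℂ E) (c : ℝ) (u : X → ℝ) (x : X) :
    g.L c u x = 0 ↔ g.laplacian u x = c * g.normSq g.form.d x * u x := by
  have h : (2 : ℝ) ≤ Module.finrank ℂ E := by exact_mod_cast hn
  have h2 : (Module.finrank ℂ E : ℝ) / ((Module.finrank ℂ E : ℝ) - 1) ≠ 0 :=
    div_ne_zero (by linarith) (by linarith)
  rw [L, mul_eq_zero, or_iff_right h2, sub_eq_zero]

theorem nonpos_of_mem_ker [CompactSpace X] [ConnectedSpace X] (hn : 2 ≤ Module.finrank ℂ E)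
    (hnK : ¬ g.IsKahler) {c : ℝ} (hc : 0 < c) {u : X → ℝ} (hu : u ∈ g.ker c) (x : X) :
    u x ≤ 0 := by
  obtain ⟨hu, hL⟩ := hu
  simp only [g.L_eq_zero_iff hn] at hL
  obtain ⟨x₁, -, hx₁⟩ := isCompact_univ.exists_isMaxOn (Set.univ_nonempty (α := X))
    hu.continuous.continuousOn
  have hmax : ∀ y, u y ≤ u x₁ := fun y => hx₁ (Set.mem_univ y)
  refine (hmax x).trans ?_
  by_contra! hpos
  -- Near a contact point `u` stays positive, so the equation makes its Laplacian nonnegative there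
  -- and the maximum principle gives openness.
  have hclopen : IsClopen {y | u y = u x₁} := by
    refine ⟨isClosed_eq hu.continuous continuous_const, isOpen_iff_mem_nhds.2 fun y hy => ?_⟩
    have hy : u y = u x₁ := hy
    have h := g.eventually_eq_of_laplacian_nonneg hu (x₀ := y) (fun w => hy ▸ hmax w) (by
      filter_upwards [hu.continuous.continuousAt.eventually (lt_mem_nhds (hy ▸ hpos : 0 < u y))]
        with w hw
      rw [hL]
      exact mul_nonneg (mul_nonneg hc.le (g.normSq_nonneg _ _)) hw.le)
    rw [hy] at h
    exact h
  have hconst : u = fun _ => u x₁ := by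
    have h := hclopen.eq_univ ⟨x₁, rfl⟩
    ext y
    exact (h.ge (Set.mem_univ y) : y ∈ {y | u y = u x₁})
  -- For a nonzero constant `u` the Laplacian vanishes, and the zeroth-order term alone forces
  -- `|dη|² = 0`.
  refine hnK fun y => g.eq_zero_of_normSq_eq_zero ?_
  have h := hL y
  rw [hconst, laplacian_const] at h
  simpa [hc.ne', hpos.ne'] using h

end HermitianMetric
end BalancedGeometry
end

theorem proposition3p2
    {E : Type*} [NormedAddCommGroup E] [NormedSpace ℂ E] [FiniteDimensional ℂ E]
    {X : Type*} [TopologicalSpace X] [ChartedSpace E X] [IsManifold 𝓘(ℂ, E) ω X]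
    [T2Space X] [CompactSpace X] [ConnectedSpace X]
    (hn : 3 ≤ Module.finrank ℂ E)
    (g : BalancedGeometry.HermitianMetric E X)
    (hbal : g.IsBalanced) (hnK : ¬ g.IsKahler)
    (c : ℝ) (hc : 0 < c) :
    g.ker c = {0} := by
  have hn2 : 2 ≤ Module.finrank ℂ E := by omega
  have h0 : ∀ x, g.L c 0 x = 0 := fun x => by
    rw [g.L_eq_zero_iff hn2]
    simpa using! g.laplacian_const 0 x
  refine Set.eq_singleton_iff_unique_mem.2 ⟨⟨contMDiff_const, h0⟩, fun u hu => ?_⟩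
  have hneg : -u ∈ g.ker c := by
    refine ⟨hu.1.neg, fun x => ?_⟩
    have h := (g.L_eq_zero_iff hn2 c u x).1 (hu.2 x)
    rw [g.L_eq_zero_iff hn2, g.laplacian_neg hu.1, h, Pi.neg_apply, mul_neg]
  ext x
  refine le_antisymm (g.nonpos_of_mem_ker hn2 hnK hc hu x) ?_
  simpa using g.nonpos_of_mem_ker hn2 hnK hc hneg x
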